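/- Let $R$ be a commutative Noetherian ring and let $Z\subseteq\operatorname{Spec}R$ be stable under specialization (if $\mathfrak p\subseteq\mathfrak q$ are primes and $\mathfrak p\in Z$, then $\mathfrak q\in Z$). Let $\mathcal T_Z$ be the class of $R$-modules $T$ with $\operatorname{Supp}(T)\subseteq Z$, let $R\text{-Mod}/\mathcal T_Z$ be the quotient category (the localization of $R\text{-Mod}$ at the morphisms whose kernel and cokernel lie in $\mathcal T_Z$), and let $t(R)$ be the largest ideal of $R$ that belongs to $\mathcal T_Z$ as an $R$-module. Let $$R_Z=\varinjlim_{\mathfrak a}\operatorname{Hom}_R(\mathfrak a,R/t(R)),$$ where $\mathfrak a$ runs through the ideals of $R$ with $R/\mathfrak a\in\mathcal T_Z$, ordered by reverse inclusion, with its canonical commutative ring structure, in which the product of the classes of $f:\mathfrak a\to R/t(R)$ and $g:\mathfrak b\to R/t(R)$ is the class of the map $\mathfrak a\mathfrak b\to R/t(R)$ with $xy\mapsto f(x)g(y)$. Let $\mu:R\to R_Z$ be the ring homomorphism that sends $r$ to the class of the map $R\to R/t(R)$, $x\mapsto xr+t(R)$. Then the following assertions are equivalent: 1. $R\text{-Mod}/\mathcal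 T_Z$ is a module category, i.e. it is equivalent to the category of all modules over some associative unital ring, not necessarily commutative. 2. $Z$ is perfect, i.e. $R_Z$ is flat as an $R$-module and $Z$ is the set of all prime ideals $\mathfrak p$ of $R$ with $\mu(\mathfrak p)R_Z=R_Z$. -/

import Mathlib

open CategoryTheory

universe u

noncomputable section

namespace SpecLocalization

/-- A category is a module category if it is equivalent to the category of all (small) modules
over some associative unital ring, not necessarily commutative. -/
def IsModuleCategory.{t, w, v} (C : Type v) [Category.{w} C] : Prop :=
  ∃ (A : Type t) (_ : Ring A), Nonempty (C ≌ ModuleCat.{t} A)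

section TorsionClass

variable {R : Type u} [CommRing R] (Z : Set (PrimeSpectrum R))

/-- The class `𝒯_Z` of the `R`-modules whose support is contained in `Z`. -/
def torsionClass : ObjectProperty (ModuleCat.{u} R) :=
  fun M => Module.support R M ⊆ Z

instance : (torsionClass Z).IsSerreClass where
  exists_zero := ⟨ModuleCat.of R PUnit, ModuleCat.isZero_of_subsingleton _, by
    simp [torsionClass, Module.support_eq_empty]⟩
  prop_of_mono f _ h :=
    (Module.support_subset_of_injective f.hom ((ModuleCat.mono_iff_injective f).1 ‹_›)).trans h
  prop_of_epi f _ h :=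
    (Module.support_subset_of_surjective f.hom ((ModuleCat.epi_iff_surjective f).1 ‹_›)).trans h
  prop_X₂_of_shortExact {S} hS h₁ h₃ := by
    have := Module.support_of_exact (f := S.f.hom) (g := S.g.hom)
      ((ShortComplex.ShortExact.moduleCat_exact_iff_function_exact S).1 hS.exact)
      hS.moduleCat_injective_f hS.moduleCat_surjective_g
    simpa [torsionClass, this] using And.intro h₁ h₃

/-- The quotient category `R-Mod / 𝒯_Z`: the localization of `R-Mod` at the morphisms whose kernel
and cokernel are in `𝒯_Z`. -/
abbrev QuotientCategory : Type (u + 1) :=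
  (torsionClass Z).isoModSerre.Localization

/-- The torsion radical `Γ_Z(M)`: the largest submodule of `M` that lies in `𝒯_Z`. -/
def torsionRadical (M : Type u) [AddCommGroup M] [Module R M] : Submodule R M :=
  sSup {N : Submodule R M | torsionClass Z (ModuleCat.of R N)}

/-- The torsion radical of `R` itself, as an ideal. -/
abbrev torsionIdeal : Ideal R := torsionRadical Z R

variable {Z}

theorem exists_smul_eq_zero_of_mem_torsionRadical {M : Type u} [AddCommGroup M] [Module R M]
    {m : M} (hm : m ∈ torsionRadical Z M) {p : PrimeSpectrum R} (hp : p ∉ Z) :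
    ∃ r ∉ p.asIdeal, r • m = 0 := by
  rw [torsionRadical, sSup_eq_iSup'] at hm
  induction hm using Submodule.iSup_induction' with
  | mem N x hx =>
    obtain ⟨r, hr, h⟩ := Module.notMem_support_iff'.1 (fun h => hp (N.2 h)) (⟨x, hx⟩ : N.1)
    exact ⟨r, hr, congrArg Subtype.val h⟩
  | zero => exact ⟨1, p.asIdeal.primeCompl.one_mem, smul_zero _⟩
  | add x y _ _ hx hy =>
    obtain ⟨r, hr, hrx⟩ := hx
    obtain ⟨s, hs, hsy⟩ := hy
    refine ⟨r * s, p.asIdeal.primeCompl.mul_mem hr hs, ?_⟩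
    rw [smul_add, mul_smul r s y, hsy, mul_comm, mul_smul, hrx, smul_zero, smul_zero, add_zero]

theorem mem_torsionRadical_iff {M : Type u} [AddCommGroup M] [Module R M] {m : M} :
    m ∈ torsionRadical Z M ↔ ∀ p ∉ Z, ∃ r ∉ p.asIdeal, r • m = 0 := by
  refine ⟨fun hm p hp => exists_smul_eq_zero_of_mem_torsionRadical hm hp, fun h => ?_⟩
  refine (le_sSup (a := Submodule.span R {m}) ?_) (Submodule.mem_span_singleton_self m)
  intro p hp
  by_contra hpZ
  obtain ⟨r, hr, hrm⟩ := h p hpZ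
  refine Module.notMem_support_iff'.2 (fun x => ⟨r, hr, ?_⟩) hp
  obtain ⟨x, hx⟩ := x
  obtain ⟨a, rfl⟩ := Submodule.mem_span_singleton.1 hx
  exact Subtype.ext (by simp [smul_comm r a, hrm])

end TorsionClass

section RingOfFractions

variable {R : Type u} [CommRing R] (Z : Set (PrimeSpectrum R))

/-- The Gabriel topology of `𝒯_Z`: the ideals `a` of `R` such that `R / a` is in `𝒯_Z`. -/
def gabrielTopology : Set (Ideal R) :=
  {a | torsionClass Z (ModuleCat.of R (R ⧸ a))}

variable {Z}

theorem mem_gabrielTopology_iff {a : Ideal R} :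
    a ∈ gabrielTopology Z ↔ PrimeSpectrum.zeroLocus (a : Set R) ⊆ Z := by
  change Module.support R (R ⧸ a) ⊆ Z ↔ _
  rw [Module.support_eq_zeroLocus, Ideal.annihilator_quotient]

theorem top_mem_gabrielTopology : (⊤ : Ideal R) ∈ gabrielTopology Z := by
  simp [mem_gabrielTopology_iff]

theorem mul_mem_gabrielTopology {a b : Ideal R} (ha : a ∈ gabrielTopology Z)
    (hb : b ∈ gabrielTopology Z) : a * b ∈ gabrielTopology Z := by
  rw [mem_gabrielTopology_iff] at *
  simpa [PrimeSpectrum.zeroLocus_mul] using And.intro ha hb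

theorem eq_zero_of_smul_eq_zero {a : Ideal R} (ha : a ∈ gabrielTopology Z)
    {s : R ⧸ torsionIdeal Z} (h : ∀ x ∈ a, x • s = 0) : s = 0 := by
  obtain ⟨r, rfl⟩ := Ideal.Quotient.mk_surjective s
  refine Ideal.Quotient.eq_zero_iff_mem.2 (mem_torsionRadical_iff.2 fun p hp => ?_)
  obtain ⟨x, hxa, hxp⟩ := SetLike.not_le_iff_exists.1
    fun hap : a ≤ p.asIdeal => hp (mem_gabrielTopology_iff.1 ha hap)
  have hxr : x * r ∈ torsionIdeal Z := Ideal.Quotient.eq_zero_iff_mem.1 (h x hxa)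
  obtain ⟨y, hy, hyx⟩ := mem_torsionRadical_iff.1 hxr p hp
  exact ⟨y * x, p.asIdeal.primeCompl.mul_mem hy hxp, by simpa [mul_assoc] using hyx⟩

variable (Z)

/-- The Gabriel topology ordered by reverse inclusion, as the index set of a direct system. -/
abbrev GabrielIndex : Type u := (gabrielTopology Z)ᵒᵈ

instance : DecidableEq (GabrielIndex Z) := Classical.decEq _

instance : Nonempty (GabrielIndex Z) := ⟨OrderDual.toDual ⟨⊤, top_mem_gabrielTopology⟩⟩

variable {Z}

/-- The ideal underlying an index. -/
def GabrielIndex.ideal (i : GabrielIndex Z) : Ideal R := (OrderDual.ofDual i).1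

theorem GabrielIndex.ideal_mem (i : GabrielIndex Z) : i.ideal ∈ gabrielTopology Z :=
  (OrderDual.ofDual i).2

theorem GabrielIndex.ideal_le {i j : GabrielIndex Z} (h : i ≤ j) : j.ideal ≤ i.ideal := h

/-- The index of the unit ideal. -/
def GabrielIndex.top : GabrielIndex Z := OrderDual.toDual ⟨⊤, top_mem_gabrielTopology⟩

/-- The index of the product of two ideals. -/
def GabrielIndex.mul (i j : GabrielIndex Z) : GabrielIndex Z :=
  OrderDual.toDual ⟨i.ideal * j.ideal, mul_mem_gabrielTopology i.ideal_mem j.ideal_mem⟩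

theorem GabrielIndex.le_mul_left (i j : GabrielIndex Z) : i ≤ i.mul j :=
  show i.ideal * j.ideal ≤ i.ideal from Ideal.mul_le_left

theorem GabrielIndex.le_mul_right (i j : GabrielIndex Z) : j ≤ i.mul j :=
  show i.ideal * j.ideal ≤ j.ideal from Ideal.mul_le_right

instance : IsDirectedOrder (GabrielIndex Z) :=
  ⟨fun i j => ⟨i.mul j, i.le_mul_left j, i.le_mul_right j⟩⟩

variable (Z)

/-- The terms `Hom_R(a, R / Γ_Z(R))` of the direct system. -/
abbrev FractionHom (i : GabrielIndex Z) : Type u := i.ideal →ₗ[R] R ⧸ torsionIdeal Z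

/-- The transition maps of the direct system: restriction to a smaller ideal. -/
def FractionHom.restrict (i j : GabrielIndex Z) (h : i ≤ j) :
    FractionHom Z i →ₗ[R] FractionHom Z j :=
  LinearMap.lcomp R _ (Submodule.inclusion (GabrielIndex.ideal_le h))

/-- The ring of fractions `R_Z`, the direct limit of `Hom_R(a, R / Γ_Z(R))` where `a` runs through
the Gabriel topology of `𝒯_Z` ordered by reverse inclusion. -/
def RingOfFractions : Type u :=
  Module.DirectLimit (FractionHom Z) (FractionHom.restrict Z)

namespace RingOfFractions

instance : AddCommGroup (RingOfFractions Z) :=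
  inferInstanceAs (AddCommGroup (Module.DirectLimit (FractionHom Z) (FractionHom.restrict Z)))

instance : Module R (RingOfFractions Z) :=
  inferInstanceAs (Module R (Module.DirectLimit (FractionHom Z) (FractionHom.restrict Z)))

/-- The canonical map from a term of the direct system to the direct limit. -/
def of (i : GabrielIndex Z) : FractionHom Z i →ₗ[R] RingOfFractions Z :=
  Module.DirectLimit.of R (GabrielIndex Z) (FractionHom Z) (FractionHom.restrict Z) i

variable {Z}

theorem of_restrict {i j : GabrielIndex Z} (h : i ≤ j) (f : FractionHom Z i) :
    of Z j (FractionHom.restrict Z i j h f) = of Z i f :=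
  Module.DirectLimit.of_f

theorem exists_of (z : RingOfFractions Z) : ∃ i f, of Z i f = z :=
  Module.DirectLimit.exists_of z

/-- Given `f` defined on `a` and `g` defined on `b`, there is a linear map on `a * b` that sends
`x * y` to `f x * g y`. -/
theorem exists_mulHom (i j : GabrielIndex Z) (f : FractionHom Z i) (g : FractionHom Z j) :
    ∃ h : FractionHom Z (i.mul j), ∀ (x : i.ideal) (y : j.ideal),
      h ⟨x.1 * y.1, Ideal.mul_mem_mul x.2 y.2⟩ = f x * g y := by
  let m : TensorProduct R i.ideal j.ideal →ₗ[R] ↥(i.ideal * j.ideal) :=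
    Submodule.mulMap' i.ideal j.ideal
  have hm : Function.Surjective m := Submodule.mulMap'_surjective _ _
  let t : TensorProduct R i.ideal j.ideal →ₗ[R] R ⧸ torsionIdeal Z :=
    TensorProduct.lift ((LinearMap.mul R (R ⧸ torsionIdeal Z)).compl₁₂ f g)
  have key : ∀ (u : i.ideal) (v : j.ideal) z,
      (u.1 * v.1) • t z = (m z).1 • (f u * g v) := by
    intro u v z
    induction z with
    | zero => simp
    | add z w hz hw => simp [smul_add, add_smul, hz, hw]
    | tmul x y =>
      have hf : u.1 • f x = x.1 • f u := by
        rw [← map_smul, ← map_smul]; exact congrArg f (Subtype.ext (mul_comm _ _))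
      have hg : v.1 • g y = y.1 • g v := by
        rw [← map_smul, ← map_smul]; exact congrArg g (Subtype.ext (mul_comm _ _))
      change (u.1 * v.1) • (f x * g y) = (x.1 * y.1) • (f u * g v)
      rw [← smul_mul_smul_comm, ← smul_mul_smul_comm, hf, hg]
  have hker : LinearMap.ker m ≤ LinearMap.ker t := by
    intro z hz
    rw [LinearMap.mem_ker] at hz ⊢
    refine eq_zero_of_smul_eq_zero (i.mul j).ideal_mem fun c hc => ?_
    refine Submodule.mul_induction_on (C := fun c => c • t z = 0) hc (fun u hu v hv => ?_)
      (fun x y hx hy => by rw [add_smul, hx, hy, add_zero])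
    simpa [hz] using key ⟨u, hu⟩ ⟨v, hv⟩ z
  refine ⟨((LinearMap.ker m).liftQ t hker).comp
    (m.quotKerEquivOfSurjective hm).symm.toLinearMap, fun x y => ?_⟩
  have : (m.quotKerEquivOfSurjective hm).symm ⟨x.1 * y.1, Ideal.mul_mem_mul x.2 y.2⟩ =
      Submodule.Quotient.mk (x ⊗ₜ[R] y) := by
    rw [LinearEquiv.symm_apply_eq]; rfl
  change (LinearMap.ker m).liftQ t hker
    ((m.quotKerEquivOfSurjective hm).symm ⟨x.1 * y.1, Ideal.mul_mem_mul x.2 y.2⟩) = _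
  rw [this]
  rfl

/-- The product of `f : a → R / Γ_Z(R)` and `g : b → R / Γ_Z(R)`, defined on `a * b`. -/
def mulHom (i j : GabrielIndex Z) (f : FractionHom Z i) (g : FractionHom Z j) :
    FractionHom Z (i.mul j) := (exists_mulHom i j f g).choose

theorem mulHom_apply {i j : GabrielIndex Z} (f : FractionHom Z i) (g : FractionHom Z j)
    {x y : R} (hx : x ∈ i.ideal) (hy : y ∈ j.ideal) :
    mulHom i j f g ⟨x * y, Ideal.mul_mem_mul hx hy⟩ = f ⟨x, hx⟩ * g ⟨y, hy⟩ :=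
  (exists_mulHom i j f g).choose_spec ⟨x, hx⟩ ⟨y, hy⟩

theorem hom_ext_mul {i j : GabrielIndex Z} {h h' : FractionHom Z (i.mul j)}
    (H : ∀ (x y : R) (hx : x ∈ i.ideal) (hy : y ∈ j.ideal),
      h ⟨x * y, Ideal.mul_mem_mul hx hy⟩ = h' ⟨x * y, Ideal.mul_mem_mul hx hy⟩) : h = h' := by
  ext ⟨z, hz⟩
  refine Submodule.mul_induction_on' (C := fun z hz => h ⟨z, hz⟩ = h' ⟨z, hz⟩)
    (fun x hx y hy => H x y hx hy) (fun x hx y hy e₁ e₂ => ?_) hz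
  exact (map_add h ⟨x, hx⟩ ⟨y, hy⟩).trans
    ((congrArg₂ (· + ·) e₁ e₂).trans (map_add h' ⟨x, hx⟩ ⟨y, hy⟩).symm)

/-- The universal property of the direct limit. -/
def lift {P : Type u} [AddCommGroup P] [Module R P] (φ : ∀ i, FractionHom Z i →ₗ[R] P)
    (hφ : ∀ i j h f, φ j (FractionHom.restrict Z i j h f) = φ i f) : RingOfFractions Z →ₗ[R] P :=
  Module.DirectLimit.lift R (GabrielIndex Z) (FractionHom Z) (FractionHom.restrict Z) φ hφ

theorem lift_of {P : Type u} [AddCommGroup P] [Module R P] (φ : ∀ i, FractionHom Z i →ₗ[R] P)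
    (hφ : ∀ i j h f, φ j (FractionHom.restrict Z i j h f) = φ i f) (i : GabrielIndex Z)
    (f : FractionHom Z i) : lift φ hφ (of Z i f) = φ i f :=
  Module.DirectLimit.lift_of φ hφ f

/-- The bilinear map that sends `f` and `g` to the class of their product. -/
def mulHomMap (i j : GabrielIndex Z) :
    FractionHom Z i →ₗ[R] FractionHom Z j →ₗ[R] RingOfFractions Z :=
  LinearMap.mk₂ R (fun f g => of Z (i.mul j) (mulHom i j f g))
    (fun f f' g => by
      rw [← map_add]; congr 1
      refine hom_ext_mul fun x y hx hy => ?_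
      simp [mulHom_apply, hx, hy, add_mul])
    (fun c f g => by
      rw [← map_smul]; congr 1
      refine hom_ext_mul fun x y hx hy => ?_
      simp [mulHom_apply, hx, hy])
    (fun f g g' => by
      rw [← map_add]; congr 1
      refine hom_ext_mul fun x y hx hy => ?_
      simp [mulHom_apply, hx, hy, mul_add])
    (fun c f g => by
      rw [← map_smul]; congr 1
      refine hom_ext_mul fun x y hx hy => ?_
      simp [mulHom_apply, hx, hy])

theorem mulHomMap_restrict_right (i : GabrielIndex Z) {j k : GabrielIndex Z} (hjk : j ≤ k)
    (f : FractionHom Z i) (g : FractionHom Z j) :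
    mulHomMap i k f (FractionHom.restrict Z j k hjk g) = mulHomMap i j f g := by
  have hle : i.mul j ≤ i.mul k := Ideal.mul_mono_right (GabrielIndex.ideal_le hjk)
  change of Z (i.mul k) (mulHom i k f (FractionHom.restrict Z j k hjk g)) =
    of Z (i.mul j) (mulHom i j f g)
  rw [← of_restrict hle]
  congr 1
  refine hom_ext_mul fun x y hx hy => ?_
  rw [mulHom_apply _ _ hx hy]
  exact (mulHom_apply f g hx (GabrielIndex.ideal_le hjk hy)).symm

theorem mulHomMap_restrict_left {i k : GabrielIndex Z} (j : GabrielIndex Z) (hik : i ≤ k)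
    (f : FractionHom Z i) (g : FractionHom Z j) :
    mulHomMap k j (FractionHom.restrict Z i k hik f) g = mulHomMap i j f g := by
  have hle : i.mul j ≤ k.mul j := Ideal.mul_mono_left (GabrielIndex.ideal_le hik)
  change of Z (k.mul j) (mulHom k j (FractionHom.restrict Z i k hik f) g) =
    of Z (i.mul j) (mulHom i j f g)
  rw [← of_restrict hle]
  congr 1
  refine hom_ext_mul fun x y hx hy => ?_
  rw [mulHom_apply _ _ hx hy]
  exact (mulHom_apply f g (GabrielIndex.ideal_le hik hx) hy).symm

variable (Z) in
/-- The multiplication of `R_Z`, as a bilinear map. -/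
def mulMap : RingOfFractions Z →ₗ[R] RingOfFractions Z →ₗ[R] RingOfFractions Z :=
  lift
    (fun i => (lift (fun j => (mulHomMap i j).flip) fun _ _ hjk g =>
      LinearMap.ext fun f => mulHomMap_restrict_right i hjk f g).flip)
    (fun i k hik f => by
      refine LinearMap.ext fun z => ?_
      obtain ⟨j, g, rfl⟩ := exists_of z
      rw [LinearMap.flip_apply, LinearMap.flip_apply, lift_of, lift_of]
      exact mulHomMap_restrict_left j hik f g)

instance : Mul (RingOfFractions Z) := ⟨fun x y => mulMap Z x y⟩

instance : One (RingOfFractions Z) :=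
  ⟨of Z GabrielIndex.top ((torsionIdeal Z).mkQ.comp (Submodule.subtype ⊤))⟩

theorem of_mul_of (i j : GabrielIndex Z) (f : FractionHom Z i) (g : FractionHom Z j) :
    of Z i f * of Z j g = of Z (i.mul j) (mulHom i j f g) := by
  change mulMap Z (of Z i f) (of Z j g) = _
  rw [mulMap, lift_of, LinearMap.flip_apply, lift_of]
  rfl

protected theorem mul_comm' (x y : RingOfFractions Z) : x * y = y * x := by
  obtain ⟨i, f, rfl⟩ := exists_of x
  obtain ⟨j, g, rfl⟩ := exists_of y
  have hle : j.mul i ≤ i.mul j := (mul_comm i.ideal j.ideal).le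
  rw [of_mul_of, of_mul_of, ← of_restrict hle]
  congr 1
  refine hom_ext_mul fun x y hx hy => ?_
  rw [mulHom_apply _ _ hx hy, mul_comm, ← mulHom_apply _ _ hy hx]
  exact congrArg (mulHom j i g f) (Subtype.ext (mul_comm y x))

protected theorem mul_assoc' (x y z : RingOfFractions Z) : x * y * z = x * (y * z) := by
  obtain ⟨i, f, rfl⟩ := exists_of x
  obtain ⟨j, g, rfl⟩ := exists_of y
  obtain ⟨k, h, rfl⟩ := exists_of z
  have hle : i.mul (j.mul k) ≤ (i.mul j).mul k := (mul_assoc i.ideal j.ideal k.ideal).le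
  simp only [of_mul_of]
  rw [← of_restrict hle]
  congr 1
  refine hom_ext_mul fun w c hw hc => ?_
  refine Submodule.mul_induction_on' (C := fun w hw =>
    mulHom (i.mul j) k (mulHom i j f g) h ⟨w * c, Ideal.mul_mem_mul hw hc⟩ =
      FractionHom.restrict Z _ _ hle (mulHom i (j.mul k) f (mulHom j k g h))
        ⟨w * c, Ideal.mul_mem_mul hw hc⟩) (fun a ha b hb => ?_) (fun a ha b hb e₁ e₂ => ?_) hw
  · have h₁ := mulHom_apply (mulHom i j f g) h (Ideal.mul_mem_mul ha hb) hc
    have h₂ := mulHom_apply f (mulHom j k g h) ha (Ideal.mul_mem_mul hb hc)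
    rw [mulHom_apply _ _ ha hb] at h₁
    rw [mulHom_apply _ _ hb hc] at h₂
    refine h₁.trans ((mul_assoc _ _ _).trans (h₂.symm.trans ?_))
    exact congrArg (mulHom i (j.mul k) f (mulHom j k g h)) (Subtype.ext (mul_assoc a b c).symm)
  · have e : (⟨(a + b) * c, Ideal.mul_mem_mul (add_mem ha hb) hc⟩ : ((i.mul j).mul k).ideal) =
        ⟨a * c, Ideal.mul_mem_mul ha hc⟩ + ⟨b * c, Ideal.mul_mem_mul hb hc⟩ :=
      Subtype.ext (add_mul a b c)
    rw [e, map_add, map_add, e₁, e₂]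

protected theorem one_mul' (x : RingOfFractions Z) : 1 * x = x := by
  obtain ⟨i, f, rfl⟩ := exists_of x
  change of Z GabrielIndex.top _ * of Z i f = _
  rw [of_mul_of, ← of_restrict (GabrielIndex.le_mul_right GabrielIndex.top i) f]
  congr 1
  refine hom_ext_mul fun x y hx hy => ?_
  rw [mulHom_apply _ _ hx hy]
  exact (map_smul f x ⟨y, hy⟩).symm

/-- The ring structure of `R_Z`. It is commutative, and the product of the classes of
`f : a → R / Γ_Z(R)` and `g : b → R / Γ_Z(R)` is the class of the map on `a * b` that sends
`x * y` to `f x * g y`. -/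
instance : CommRing (RingOfFractions Z) :=
  { (inferInstance : AddCommGroup (RingOfFractions Z)),
    (inferInstance : Mul (RingOfFractions Z)),
    (inferInstance : One (RingOfFractions Z)) with
    left_distrib := fun x y z => map_add (mulMap Z x) y z
    right_distrib := fun x y z => LinearMap.map_add₂ (mulMap Z) x y z
    zero_mul := fun x => LinearMap.map_zero₂ (mulMap Z) x
    mul_zero := fun x => map_zero (mulMap Z x)
    mul_assoc := RingOfFractions.mul_assoc'
    mul_comm := RingOfFractions.mul_comm'
    one_mul := RingOfFractions.one_mul'
    mul_one := fun x => (RingOfFractions.mul_comm' x 1).trans (RingOfFractions.one_mul' x) }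

variable (Z) in
/-- The composite `R → R / Γ_Z(R) ≅ Hom_R(R, R / Γ_Z(R)) → R_Z` of canonical maps, which sends `r`
to the class of `x ↦ x • [r]`. -/
def canonicalMap : R →ₗ[R] RingOfFractions Z :=
  (of Z GabrielIndex.top).comp <|
    (LinearMap.lcomp R (R ⧸ torsionIdeal Z) (Submodule.subtype (⊤ : Ideal R))).comp <|
      (LinearMap.ringLmapEquivSelf R R (R ⧸ torsionIdeal Z)).symm.toLinearMap.comp
        (torsionIdeal Z).mkQ

theorem canonicalMap_one : canonicalMap Z 1 = 1 := by
  refine congrArg (of Z GabrielIndex.top) (LinearMap.ext fun x => ?_)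
  change x.1 • (torsionIdeal Z).mkQ 1 = (torsionIdeal Z).mkQ x.1
  rw [← map_smul, smul_eq_mul, mul_one]

theorem canonicalMap_eq_smul_one (r : R) : canonicalMap Z r = r • 1 := by
  rw [← canonicalMap_one, ← map_smul, smul_eq_mul, mul_one]

protected theorem smul_mul' (r : R) (x y : RingOfFractions Z) : r • x * y = r • (x * y) :=
  LinearMap.map_smul₂ (mulMap Z) r x y

variable (Z) in
/-- The canonical ring homomorphism `μ : R → R_Z`. -/
def canonicalHom : R →+* RingOfFractions Z :=
  { canonicalMap Z with
    map_one' := canonicalMap_one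
    map_zero' := map_zero (canonicalMap Z)
    map_mul' := fun r s => by
      change canonicalMap Z (r * s) = canonicalMap Z r * canonicalMap Z s
      rw [canonicalMap_eq_smul_one r, RingOfFractions.smul_mul', one_mul, ← map_smul, smul_eq_mul] }

/-- `R_Z` is an `R`-algebra through the canonical homomorphism `μ`, and the `R`-module structure is
that of the direct limit. -/
instance : Algebra R (RingOfFractions Z) where
  algebraMap := canonicalHom Z
  commutes' r x := mul_comm _ _
  smul_def' r x := by
    change _ = canonicalMap Z r * x
    rw [canonicalMap_eq_smul_one, RingOfFractions.smul_mul', one_mul]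

end RingOfFractions

/-- `Z` is perfect if `R_Z` is flat as an `R`-module and `Z` consists of the primes `p` such that
`μ(p) R_Z = R_Z`, where `μ : R → R_Z` is the canonical ring homomorphism. -/
def IsPerfect : Prop :=
  Module.Flat R (RingOfFractions Z) ∧
    Z = {p | p.asIdeal.map (RingOfFractions.canonicalHom Z) = ⊤}

end RingOfFractions

end SpecLocalization

end

/-! Perfect implies module category: base change along `R → R_Z` is exact by flatness, and the
description of `Z` gives `I R_Z = R_Z` for every `I` in the Gabriel topology. Hence `R_Z`-modules
have no nonzero `Z`-torsion, `R`-linear maps between them are `R_Z`-linear, and base change kills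
exactly `𝒯_Z`. An exact left adjoint with fully faithful right adjoint is the localization at its
kernel, so the quotient category is `R_Z`-Mod.

Conversely, let `L : R-Mod ⥤ A-Mod` be the exact localization functor and `B = L(R)`, with `R`
acting by functoriality. Finite presentations over the Noetherian ring `R` show that `B` is `R`-flat
(`flat_fiber`) and that `I B = B` iff `R/I` lies in `𝒯_Z` (`smul_top_fiber_eq_top_iff`). Calculus of
fractions gives `R_Z ≅ End_A(B)` as `R`-modules, so it remains to pass from `B` to `End_A(B)`. Now
`B` generates `A`-Mod, so its trace ideal is `A` (`exists_trace_eq_one`), and `End_A(B)` is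
commutative (`comp_comm`). A Nakayama argument over `End_A(B)` then yields a finite dual basis of
`B` over `A`, which makes `End_A(B)` an `R`-linear retract of some `B^m` and carries over both
properties. -/

noncomputable section

namespace SpecLocalization

/-! ### Dual bases and passage from a module to its endomorphism ring. -/

section DualBasis

variable {A B : Type*} [Ring A] [AddCommGroup B] [Module A B]

/-- Let `B` be a module over a ring `A` with commutative endomorphism ring. If the trace ideal of
`B` contains `1`, then `B` has a finite dual basis. -/
theorem exists_dualBasis_of_trace_eq_one (hc : ∀ φ ψ : Module.End A B, φ * ψ = ψ * φ)
    {n : ℕ} (f : Fin n → B →ₗ[A] A) (b : Fin n → B) (h : ∑ i, f i (b i) = 1) :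
    ∃ (m : ℕ) (g : Fin m → B →ₗ[A] A) (c : Fin m → B), ∀ x, ∑ i, g i x • c i = x := by
  let : CommRing (Module.End A B) :=
    { (inferInstance : Ring (Module.End A B)) with mul_comm := hc }
  let T : Ideal (Module.End A B) := Ideal.span {φ | ∃ (x : B) (g : B →ₗ[A] A), φ = g.smulRight x}
  -- This one identity shows both that the `b i` generate `B` over its endomorphism ring and that `T
  -- B = B`.
  have key : ∀ x : B, ∑ i, ((f i).smulRight x : Module.End A B) • b i = x := fun x => by
    simp only [Module.End.smul_def, LinearMap.smulRight_apply]
    rw [← Finset.sum_smul, h, one_smul]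
  have hfg : (⊤ : Submodule (Module.End A B) B).FG := by
    refine ⟨(Set.finite_range b).toFinset, top_le_iff.1 fun x _ => ?_⟩
    rw [← key x]
    exact Submodule.sum_mem _ fun i _ => Submodule.smul_mem _ _ (Submodule.subset_span (by simp))
  have hle : (⊤ : Submodule (Module.End A B) B) ≤ T • ⊤ := fun x _ => by
    rw [← key x]
    exact Submodule.sum_mem _ fun i _ =>
      Submodule.smul_mem_smul (Ideal.subset_span ⟨x, f i, rfl⟩) trivial
  -- Nakayama gives `r ≡ 1` modulo `T` with `r B = 0`. Endomorphisms act faithfully, so `r = 0` and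
  -- `1 ∈ T`.
  obtain ⟨r, hr, hr0⟩ :=
    Submodule.exists_sub_one_mem_and_smul_eq_zero_of_fg_of_le_smul T ⊤ hfg hle
  have hr' : r = 0 := LinearMap.ext fun x => hr0 x trivial
  have h1 : (1 : Module.End A B) ∈ T := by
    rw [hr', zero_sub] at hr
    exact neg_mem_iff.1 hr
  obtain ⟨m, σ, g, hg⟩ := Submodule.mem_span_set'.1 h1
  choose c γ hcγ using fun i => (g i).2
  -- The coefficients are absorbed into the vectors: `σ (γ x • c) = γ x • σ c`.
  refine ⟨m, γ, fun i => σ i (c i), fun x => ?_⟩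
  have := congrArg (fun φ : Module.End A B => φ x) hg
  simp only [hcγ, LinearMap.sum_apply] at this
  refine Eq.trans (Finset.sum_congr rfl fun i _ => ?_) this
  exact (map_smul (σ i) _ _).symm

variable {R : Type*} [CommRing R] [Module R B] [SMulCommClass A R B]
  {m : ℕ} {g : Fin m → B →ₗ[A] A} {c : Fin m → B}

/-- The `R`-linear map that sends `y` to the endomorphism `x ↦ g x • y`. -/
def smulRightMap (R : Type*) [CommRing R] [Module R B] [SMulCommClass A R B] (g : B →ₗ[A] A) :
    B →ₗ[R] Module.End A B where
  toFun y := g.smulRight y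
  map_add' y z := by ext; simp
  map_smul' r y := by ext x; exact smul_comm (g x) r y

/-- Evaluation of endomorphisms at a vector, as an `R`-linear map. -/
def evalMap (R : Type*) [CommRing R] [Module R B] [SMulCommClass A R B] (x : B) :
    Module.End A B →ₗ[R] B where
  toFun φ := φ x
  map_add' _ _ := rfl
  map_smul' _ _ := rfl

/-- Applying `φ` to the dual basis expansion of `x` recovers `φ` from its values on the `c i`. This
is the retraction of `B^m` onto the endomorphism ring. -/
theorem sum_smulRightMap_evalMap (hgc : ∀ x, ∑ i, g i x • c i = x) (φ : Module.End A B) :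
    ∑ i, smulRightMap R (g i) (evalMap R (c i) φ) = φ := by
  ext x
  conv_rhs => rw [← hgc x]
  simp [smulRightMap, evalMap]

theorem flat_end_of_dualBasis (hgc : ∀ x, ∑ i, g i x • c i = x) [Module.Flat R B] :
    Module.Flat R (Module.End A B) := by
  have : Module.Flat R (Fin m → B) :=
    .of_linearEquiv (DirectSum.linearEquivFunOnFintype R (Fin m) fun _ => B).symm
  refine Module.Flat.of_retract (M := Fin m → B) (LinearMap.pi fun i => evalMap R (c i))
    (∑ i, smulRightMap R (g i) ∘ₗ LinearMap.proj i) (LinearMap.ext fun φ => ?_)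
  simpa using sum_smulRightMap_evalMap hgc φ

/-- Evaluation at `x` sends `1` to `x`, which gives one direction. The other rebuilds `φ` from the
values `φ (c i)`. -/
theorem smul_top_end_eq_top_iff (hgc : ∀ x, ∑ i, g i x • c i = x) (I : Ideal R) :
    I • (⊤ : Submodule R (Module.End A B)) = ⊤ ↔ I • (⊤ : Submodule R B) = ⊤ := by
  constructor
  · refine fun h => top_le_iff.1 fun x _ => ?_
    have h1 : (1 : Module.End A B) ∈ I • (⊤ : Submodule R (Module.End A B)) := by rw [h]; trivial
    have := Submodule.mem_map_of_mem (f := evalMap R x) h1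
    rw [Submodule.map_smul''] at this
    exact Submodule.smul_mono le_rfl le_top this
  · refine fun h => top_le_iff.1 fun φ _ => ?_
    rw [← sum_smulRightMap_evalMap (R := R) hgc φ]
    refine Submodule.sum_mem _ fun i _ => ?_
    have h1 : evalMap R (c i) φ ∈ I • (⊤ : Submodule R B) := by rw [h]; trivial
    have := Submodule.mem_map_of_mem (f := smulRightMap R (g i)) h1
    rw [Submodule.map_smul''] at this
    exact Submodule.smul_mono le_rfl le_top this

end DualBasis

/-! ### Torsion elements, the Gabriel topology and morphisms to be inverted. -/

section Torsion

variable {R : Type u} [CommRing R] {Z : Set (PrimeSpectrum R)}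

theorem torsionClass_of_iff {M : Type u} [AddCommGroup M] [Module R M] :
    torsionClass Z (ModuleCat.of R M) ↔ ∀ m : M, m ∈ torsionRadical Z M := by
  simp only [mem_torsionRadical_iff]
  constructor
  · intro h m p hp
    exact Module.notMem_support_iff'.1 (fun hs => hp (h hs)) m
  · intro h p hp
    by_contra hpZ
    exact Module.notMem_support_iff'.2 (fun m => h m p hpZ) hp

theorem mem_torsionRadical_of_injective {M N : Type u} [AddCommGroup M] [Module R M]
    [AddCommGroup N] [Module R N] (f : M →ₗ[R] N) (hf : Function.Injective f) {m : M} :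
    f m ∈ torsionRadical Z N ↔ m ∈ torsionRadical Z M := by
  simp only [mem_torsionRadical_iff, ← map_smul, map_eq_zero_iff f hf]

theorem torsionClass_image_iff {M N : ModuleCat.{u} R} (f : M ⟶ N) :
    torsionClass Z (Abelian.image f) ↔ ∀ m : M, f.hom m ∈ torsionRadical Z N := by
  have e : torsionClass Z (Abelian.image f) ↔ torsionClass Z (ModuleCat.of R f.hom.range) :=
    (torsionClass Z).prop_iff_of_iso
      (Abelian.imageIsoImage f ≪≫ ModuleCat.imageIsoRange f)
  rw [e, torsionClass_of_iff]
  constructor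
  · intro h m
    exact (mem_torsionRadical_of_injective f.hom.range.subtype Subtype.val_injective).2
      (h ⟨_, m, rfl⟩)
  · rintro h ⟨_, m, rfl⟩
    exact (mem_torsionRadical_of_injective f.hom.range.subtype Subtype.val_injective).1 (h m)

/-- The annihilator of a torsion element lies in the Gabriel topology, and no such ideal kills a
nonzero element of `R / t(R)`. -/
theorem mem_torsionRadical_quotient_torsionIdeal {x : R ⧸ torsionIdeal Z}
    (hx : x ∈ torsionRadical Z (R ⧸ torsionIdeal Z)) : x = 0 := by
  rw [mem_torsionRadical_iff] at hx
  refine eq_zero_of_smul_eq_zero (Z := Z) (a := (Submodule.span R {x}).annihilator) ?_ fun r hr =>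
    (Submodule.mem_annihilator_span_singleton _ _).1 hr
  refine mem_gabrielTopology_iff.2 fun p hp => ?_
  by_contra hpZ
  obtain ⟨r, hr, h⟩ := hx p hpZ
  exact hr (hp ((Submodule.mem_annihilator_span_singleton _ _).2 h))

theorem isoModSerre_subtype {I : Ideal R} (hI : I ∈ gabrielTopology Z) :
    (torsionClass Z).isoModSerre (ModuleCat.ofHom I.subtype) := by
  have : Mono (ModuleCat.ofHom I.subtype) :=
    (ModuleCat.mono_iff_injective _).2 Subtype.val_injective
  refine (torsionClass Z).isoModSerre_of_mono _ ?_
  refine ((torsionClass Z).prop_iff_of_iso (ModuleCat.cokernelIsoRangeQuotient _)).2 ?_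
  change torsionClass Z (ModuleCat.of R (R ⧸ LinearMap.range I.subtype))
  rw [Submodule.range_subtype]
  exact hI

theorem isoModSerre_mkQ : (torsionClass Z).isoModSerre (ModuleCat.ofHom (torsionIdeal Z).mkQ) := by
  have : Epi (ModuleCat.ofHom (torsionIdeal Z).mkQ) :=
    (ModuleCat.epi_iff_surjective _).2 (Submodule.mkQ_surjective _)
  refine (torsionClass Z).isoModSerre_of_epi _ ?_
  refine ((torsionClass Z).prop_iff_of_iso (ModuleCat.kernelIsoKer _)).2 ?_
  change torsionClass Z (ModuleCat.of R (LinearMap.ker (torsionIdeal Z).mkQ))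
  rw [Submodule.ker_mkQ, torsionClass_of_iff]
  rintro ⟨x, hx⟩
  exact (mem_torsionRadical_of_injective (torsionIdeal Z).subtype Subtype.val_injective).1 hx

theorem range_mem_gabrielTopology {X : ModuleCat.{u} R} {w : X ⟶ ModuleCat.of R R}
    (hw : (torsionClass Z).isoModSerre w) : LinearMap.range w.hom ∈ gabrielTopology Z :=
  ((torsionClass Z).prop_iff_of_iso (ModuleCat.cokernelIsoRangeQuotient w)).1 hw.2

/-- The support of `R/p` is the closure of `p`. This is where stability under specialization enters.
-/
theorem torsionClass_quotient_prime_iff (hZ : StableUnderSpecialization Z) (p : PrimeSpectrum R) :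
    torsionClass Z (ModuleCat.of R (R ⧸ p.asIdeal)) ↔ p ∈ Z := by
  refine mem_gabrielTopology_iff.trans ⟨fun h => h (le_refl p.asIdeal), fun hp q hq => ?_⟩
  exact hZ ((PrimeSpectrum.le_iff_specializes p q).1 hq) hp

end Torsion

/-! ### The `R`-module `L(R)` for an additive functor `L`, and consequences of exactness. -/

section ScalarAction

variable {R : Type u} [CommRing R] {A : Type u} [Ring A]
  (L : ModuleCat.{u} R ⥤ ModuleCat.{u} A) [L.Additive]

/-- The morphism `R ⟶ X` that corresponds to an element of `X`. -/
def elementHom {X : ModuleCat.{u} R} (x : X) : ModuleCat.of R R ⟶ X :=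
  ModuleCat.ofHom (LinearMap.toSpanSingleton R X x)

theorem elementHom_comp {X Y : ModuleCat.{u} R} (x : X) (f : X ⟶ Y) :
    elementHom x ≫ f = elementHom (f.hom x) := by
  ext; simp [elementHom]

theorem elementHom_eq_smul (r : R) :
    elementHom (X := ModuleCat.of R R) r = r • 𝟙 (ModuleCat.of R R) := by
  ext; simp [elementHom]

/-- The image of the free module of rank one under `L`. -/
abbrev Fiber : Type u := L.obj (ModuleCat.of R R)

/-- `R` acts on `L(R)` by functoriality. -/
instance : Module R (Fiber L) where
  smul r b := (L.map (r • 𝟙 (ModuleCat.of R R))).hom b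
  one_smul b := by change (L.map _).hom b = b; simp
  mul_smul r s b := by
    change (L.map _).hom b = (L.map _).hom ((L.map _).hom b)
    rw [← ModuleCat.comp_apply, ← L.map_comp, Linear.smul_comp, Category.id_comp, smul_smul,
      mul_comm]
  smul_zero r := map_zero _
  smul_add r := map_add (L.map _).hom
  add_smul r s b := by
    change (L.map _).hom b = (L.map _).hom b + (L.map _).hom b
    rw [add_smul, L.map_add]; rfl
  zero_smul b := by
    change (L.map _).hom b = 0
    rw [zero_smul, L.map_zero]; rfl

theorem fiber_smul_def (r : R) (b : Fiber L) :
    r • b = (L.map (r • 𝟙 (ModuleCat.of R R))).hom b := rfl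

instance : SMulCommClass A R (Fiber L) where
  smul_comm a r b := (map_smul (L.map (r • 𝟙 (ModuleCat.of R R))).hom a b).symm

/-- Coordinate projection. -/
def projHom (R : Type u) [CommRing R] {n : ℕ} (i : Fin n) :
    ModuleCat.of R (Fin n → R) ⟶ ModuleCat.of R R :=
  ModuleCat.ofHom (LinearMap.proj i)

/-- Coordinate inclusion. -/
def singleHom (R : Type u) [CommRing R] {n : ℕ} (i : Fin n) :
    ModuleCat.of R R ⟶ ModuleCat.of R (Fin n → R) :=
  ModuleCat.ofHom (LinearMap.single R (fun _ => R) i)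

theorem sum_projHom_singleHom (n : ℕ) :
    ∑ i, projHom R i ≫ singleHom R i = 𝟙 (ModuleCat.of R (Fin n → R)) := by
  refine ModuleCat.hom_ext (LinearMap.ext fun x => ?_)
  rw [ModuleCat.hom_sum, LinearMap.sum_apply]
  exact Finset.univ_sum_single x

theorem map_apply_eq_sum {n : ℕ} {X : ModuleCat.{u} R} (φ : ModuleCat.of R (Fin n → R) ⟶ X)
    (y : L.obj (ModuleCat.of R (Fin n → R))) :
    (L.map φ).hom y = ∑ i, (L.map (singleHom R i ≫ φ)).hom ((L.map (projHom R i)).hom y) := by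
  have h : φ = ∑ i, projHom R i ≫ singleHom R i ≫ φ := by
    simp_rw [← Category.assoc]
    rw [← Preadditive.sum_comp, sum_projHom_singleHom, Category.id_comp]
  conv_lhs => rw [h, L.map_sum, ModuleCat.hom_sum, LinearMap.sum_apply]
  simp only [L.map_comp, ModuleCat.comp_apply]

theorem singleHom_comp_projHom {n : ℕ} (i j : Fin n) :
    singleHom R i ≫ projHom R j = if i = j then 𝟙 _ else 0 := by
  refine ModuleCat.hom_ext (LinearMap.ext_ring ?_)
  split_ifs with h
  · subst h; simp [singleHom, projHom]
  · simp [singleHom, projHom, Ne.symm h]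

theorem hom_eq_smul_id (φ : ModuleCat.of R R ⟶ ModuleCat.of R R) :
    φ = (φ.hom (1 : R) : R) • 𝟙 (ModuleCat.of R R) := by
  refine ModuleCat.hom_ext (LinearMap.ext_ring ?_)
  simp

theorem map_exact [Limits.PreservesFiniteLimits L] [Limits.PreservesFiniteColimits L]
    {X Y W : ModuleCat.{u} R} (f : X ⟶ Y) (g : Y ⟶ W) (h : Function.Exact f.hom g.hom) :
    Function.Exact (L.map f).hom (L.map g).hom := by
  have w : f ≫ g = 0 := ModuleCat.hom_ext h.linearMap_comp_eq_zero
  have hS : (ShortComplex.mk f g w).Exact :=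
    (ShortComplex.ShortExact.moduleCat_exact_iff_function_exact _).2 h
  exact (ShortComplex.ShortExact.moduleCat_exact_iff_function_exact _).1 (hS.map L)

/-- Equational criterion: a relation in `L(R)` is an element of `L(R^l)` killed by `L(φ)`. Since
`ker φ` is finitely generated, exactness lifts that element to some `L(R^k)`. -/
theorem flat_fiber [IsNoetherianRing R] [Limits.PreservesFiniteLimits L]
    [Limits.PreservesFiniteColimits L] : Module.Flat R (Fiber L) := by
  refine Module.Flat.iff_forall_isTrivialRelation.2 fun {l f x} hfx => ?_
  let φ : ModuleCat.of R (Fin l → R) ⟶ ModuleCat.of R R :=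
    ModuleCat.ofHom (Fintype.linearCombination R f)
  obtain ⟨k, ψ, hψ⟩ := (Submodule.fg_iff_exists_fin_linearMap _ _).1
    (IsNoetherian.noetherian (LinearMap.ker φ.hom))
  let ψ' : ModuleCat.of R (Fin k → R) ⟶ ModuleCat.of R (Fin l → R) := ModuleCat.ofHom ψ
  have hex : Function.Exact ψ'.hom φ.hom := LinearMap.exact_iff.2 hψ.symm
  have hφ : ∀ i, singleHom R i ≫ φ = f i • 𝟙 (ModuleCat.of R R) := fun i => by
    rw [hom_eq_smul_id (singleHom R i ≫ φ)]
    congr 1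
    simp [singleHom, φ, Fintype.linearCombination_apply, Pi.single_apply]
  let X : L.obj (ModuleCat.of R (Fin l → R)) := ∑ i, (L.map (singleHom R i)).hom (x i)
  have hX : (L.map φ).hom X = 0 := by
    rw [map_sum, ← hfx]
    refine Finset.sum_congr rfl fun i _ => ?_
    rw [← ModuleCat.comp_apply, ← L.map_comp, hφ]
    rfl
  obtain ⟨Y, hY⟩ := (map_exact L ψ' φ hex X).1 hX
  -- The relation is trivialized by the matrix of `ψ` and the coordinates of the lift `Y`.
  refine ⟨k, fun i j => (singleHom R j ≫ ψ' ≫ projHom R i).hom (1 : R),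
    fun j => (L.map (projHom R j)).hom Y, fun i => ?_, fun j => ?_⟩
  · have hxi : x i = (L.map (projHom R i)).hom X := by
      rw [map_sum, Finset.sum_eq_single i]
      · rw [← ModuleCat.comp_apply, ← L.map_comp, singleHom_comp_projHom, if_pos rfl, L.map_id]
        rfl
      · intro j _ hj
        rw [← ModuleCat.comp_apply, ← L.map_comp, singleHom_comp_projHom, if_neg hj, L.map_zero]
        rfl
      · simp
    rw [hxi, ← hY, ← ModuleCat.comp_apply, ← L.map_comp, map_apply_eq_sum]
    refine Finset.sum_congr rfl fun j _ => ?_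
    rw [fiber_smul_def, ← hom_eq_smul_id]
  · have : φ.hom (ψ'.hom (Pi.single j 1)) = 0 := hex.apply_apply_eq_zero _
    rw [← this]
    simp [singleHom, projHom, φ, ψ', Fintype.linearCombination_apply, mul_comm]

/-- For a presentation `R^k → R → R/I → 0`, exactness makes `L(R/I)` the cokernel of `L(R^k) →
L(R)`, whose image is `I L(R)`. -/
theorem smul_top_fiber_eq_top_iff [IsNoetherianRing R] [Limits.PreservesFiniteLimits L]
    [Limits.PreservesFiniteColimits L] (I : Ideal R) :
    I • (⊤ : Submodule R (Fiber L)) = ⊤ ↔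
      Limits.IsZero (L.obj (ModuleCat.of R (R ⧸ I))) := by
  let q : ModuleCat.of R R ⟶ ModuleCat.of R (R ⧸ I) := ModuleCat.ofHom I.mkQ
  have : Epi q := (ModuleCat.epi_iff_surjective _).2 (Submodule.mkQ_surjective _)
  have hq : Function.Surjective (L.map q).hom :=
    (ModuleCat.epi_iff_surjective _).1 inferInstance
  rw [ModuleCat.isZero_iff_subsingleton]
  constructor
  · intro h
    refine subsingleton_of_forall_eq 0 fun y => ?_
    obtain ⟨b, rfl⟩ := hq y
    have hb : (b : Fiber L) ∈ I • (⊤ : Submodule R (Fiber L)) := by rw [h]; trivial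
    refine Submodule.smul_induction_on (p := fun b : Fiber L => (L.map q).hom b = 0) hb
      (fun r hr n _ => ?_) (fun x y hx hy => ?_)
    · rw [fiber_smul_def, ← ModuleCat.comp_apply, ← L.map_comp]
      have : (r • 𝟙 (ModuleCat.of R R)) ≫ q = 0 := by
        refine ModuleCat.hom_ext (LinearMap.ext_ring ?_)
        simpa [q, Algebra.smul_def] using Ideal.Quotient.eq_zero_iff_mem.2 hr
      rw [this, L.map_zero]
      rfl
    · exact (map_add (L.map q).hom x y).trans (by rw [hx, hy, add_zero])
  · intro h
    obtain ⟨k, ψ, hψ⟩ := (Submodule.fg_iff_exists_fin_linearMap _ _).1 (IsNoetherian.noetherian I)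
    let ψ' : ModuleCat.of R (Fin k → R) ⟶ ModuleCat.of R R := ModuleCat.ofHom ψ
    have hex : Function.Exact ψ'.hom q.hom :=
      LinearMap.exact_iff.2 ((Submodule.ker_mkQ I).trans hψ.symm)
    refine top_le_iff.1 fun b _ => ?_
    obtain ⟨Y, hY⟩ := (map_exact L ψ' q hex b).1 (Subsingleton.elim _ _)
    rw [← hY, map_apply_eq_sum]
    refine Submodule.sum_mem _ fun i _ => ?_
    rw [hom_eq_smul_id (singleHom R i ≫ ψ'), ← fiber_smul_def]
    refine Submodule.smul_mem_smul ?_ trivial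
    rw [← hψ]
    exact ⟨_, rfl⟩

end ScalarAction

open TensorProduct

theorem isoModSerre_congr {C : Type*} [Category* C] [Abelian C] {P Q : ObjectProperty C}
    [P.IsSerreClass] [Q.IsSerreClass] (h : P = Q) : P.isoModSerre = Q.isoModSerre := by
  subst h
  rfl

/-! ### Perfect subsets: the quotient category is `R_Z`-Mod. -/

section PerfectToModuleCategory

variable {R : Type u} [CommRing R] {Z : Set (PrimeSpectrum R)}

/-- If `a` is the class of `f` and `x` is in its domain, then `x • a` is the class of `y ↦ y • f x`,
hence the image of any lift of `f x` to `R`. -/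
theorem RingOfFractions.exists_gabriel_smul_eq (a : RingOfFractions Z) :
    ∃ I ∈ gabrielTopology Z, ∀ x ∈ I, ∃ r : R, x • a = algebraMap R (RingOfFractions Z) r := by
  obtain ⟨i, f, rfl⟩ := exists_of a
  refine ⟨i.ideal, i.ideal_mem, fun x hx => ?_⟩
  obtain ⟨r, hr⟩ := (torsionIdeal Z).mkQ_surjective (f ⟨x, hx⟩)
  refine ⟨r, ?_⟩
  have hle : GabrielIndex.top ≤ i := (le_top : i.ideal ≤ ⊤)
  rw [← map_smul]
  change _ = of Z GabrielIndex.top _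
  rw [← of_restrict hle]
  congr 1
  ext y
  change x • f y = y.1 • (torsionIdeal Z).mkQ r
  rw [hr, ← map_smul, ← map_smul]
  exact congrArg f (Subtype.ext (mul_comm _ _))

variable (hZ : Z = {p | p.asIdeal.map (RingOfFractions.canonicalHom Z) = ⊤})
include hZ

/-- Otherwise a maximal ideal over `I R_Z` contracts to a prime `p ∈ Z`, and `p R_Z = R_Z` would lie
in that maximal ideal. -/
theorem map_eq_top_of_mem_gabrielTopology {I : Ideal R} (hI : I ∈ gabrielTopology Z) :
    I.map (algebraMap R (RingOfFractions Z)) = ⊤ := by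
  by_contra h
  obtain ⟨m, hm, hle⟩ := Ideal.exists_le_maximal _ h
  have := hm.isPrime
  let p : PrimeSpectrum R := ⟨m.comap (algebraMap R (RingOfFractions Z)), inferInstance⟩
  have hp : p ∈ Z := mem_gabrielTopology_iff.1 hI (Ideal.map_le_iff_le_comap.1 hle)
  rw [hZ] at hp
  exact hm.ne_top (top_le_iff.1 (hp.symm.le.trans Ideal.map_comap_le))

theorem eq_zero_of_forall_smul_eq_zero {I : Ideal R} (hI : I ∈ gabrielTopology Z)
    {N : Type*} [AddCommGroup N] [Module R N] [Module (RingOfFractions Z) N]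
    [IsScalarTower R (RingOfFractions Z) N] {n : N} (h : ∀ x ∈ I, x • n = 0) : n = 0 := by
  have hle : I.map (algebraMap R (RingOfFractions Z)) ≤
      LinearMap.ker (LinearMap.toSpanSingleton (RingOfFractions Z) N n) :=
    Ideal.map_le_iff_le_comap.2 fun x hx => by simpa using h x hx
  rw [map_eq_top_of_mem_gabrielTopology hZ hI, top_le_iff] at hle
  simpa using (hle ▸ trivial : (1 : RingOfFractions Z) ∈
    LinearMap.ker (LinearMap.toSpanSingleton (RingOfFractions Z) N n))

/-- By flatness the cyclic submodules `R / ann m` also tensor to zero, so `ann m`, and every prime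
above it, extends to `R_Z`. Conversely, if the support lies in `Z`, each `s ⊗ m` is killed by `ann
m`, an ideal of the Gabriel topology. -/
theorem subsingleton_tensor_iff [Module.Flat R (RingOfFractions Z)]
    (M : Type u) [AddCommGroup M] [Module R M] :
    Subsingleton (RingOfFractions Z ⊗[R] M) ↔ Module.support R M ⊆ Z := by
  constructor
  · intro h p hp
    obtain ⟨m, hm⟩ := Module.mem_support_iff_exists_annihilator.1 hp
    let ψ := LinearMap.toSpanSingleton R M m
    have hinj : Function.Injective (ψ.ker.liftQ ψ le_rfl) := by
      rw [← LinearMap.ker_eq_bot]; exact Submodule.ker_liftQ_eq_bot _ _ _ le_rfl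
    have h1 := Module.Flat.lTensor_preserves_injective_linearMap (M := RingOfFractions Z) _ hinj
    have : Subsingleton (RingOfFractions Z ⊗[R] (R ⧸ ψ.ker)) := h1.subsingleton
    have : Subsingleton (RingOfFractions Z ⧸ (ψ.ker • ⊤ : Submodule R (RingOfFractions Z))) :=
      (TensorProduct.tensorQuotEquivQuotSMul (RingOfFractions Z) ψ.ker).symm.injective.subsingleton
    rw [Submodule.Quotient.subsingleton_iff, Ideal.smul_top_eq_map,
      Submodule.restrictScalars_eq_top_iff] at this
    rw [hZ]
    refine top_le_iff.1 (this.symm.le.trans (Ideal.map_mono fun x hx => hm ?_))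
    rw [Submodule.mem_annihilator_span_singleton]
    simpa [ψ] using hx
  · intro h
    refine subsingleton_of_forall_eq 0 fun z => ?_
    induction z with
    | zero => rfl
    | add x y hx hy => rw [hx, hy, add_zero]
    | tmul s m =>
      have hI : (R ∙ m).annihilator ∈ gabrielTopology Z :=
        mem_gabrielTopology_iff.2 fun p hp =>
          h (Module.mem_support_iff_exists_annihilator.2 ⟨m, hp⟩)
      refine eq_zero_of_forall_smul_eq_zero hZ hI fun x hx => ?_
      rw [← tmul_smul, (Submodule.mem_annihilator_span_singleton _ _).1 hx, tmul_zero]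

/-- The defect `f (s m) - s f(m)` is killed by every `x` with `x s` in the image of `R`; such `x`
contain an ideal of the Gabriel topology. -/
theorem full_restrictScalars_ringOfFractions :
    (ModuleCat.restrictScalars.{u} (algebraMap R (RingOfFractions Z))).Full where
  map_surjective {M N} f := by
    let S := RingOfFractions Z
    let : Module R M := Module.compHom M (algebraMap R S)
    let : Module R N := Module.compHom N (algebraMap R S)
    have : IsScalarTower R S M := ⟨fun r s m => by
      rw [Algebra.smul_def, mul_smul]; rfl⟩
    have : IsScalarTower R S N := ⟨fun r s m => by
      rw [Algebra.smul_def, mul_smul]; rfl⟩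
    let f' : M →ₗ[R] N := f.hom
    refine ⟨ModuleCat.ofHom { toFun := f', map_add' := map_add f', map_smul' := fun s m => ?_ }, ?_⟩
    · obtain ⟨I, hI, h⟩ := s.exists_gabriel_smul_eq
      refine sub_eq_zero.1 (eq_zero_of_forall_smul_eq_zero hZ hI fun x hx => ?_)
      obtain ⟨r, hr⟩ := h x hx
      rw [smul_sub, ← map_smul, RingHom.id_apply, ← smul_assoc, ← smul_assoc, hr,
        algebraMap_smul, algebraMap_smul, map_smul, sub_self]
    · rfl

theorem isModuleCategory_of_flat [Module.Flat R (RingOfFractions Z)] :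
    IsModuleCategory.{u} (QuotientCategory Z) := by
  let S := RingOfFractions Z
  let G := ModuleCat.extendScalars.{u, u, u} (algebraMap R S)
  have : Limits.PreservesFiniteLimits G :=
    ModuleCat.preservesFiniteLimits_extendScalars_of_flat
      (RingHom.flat_algebraMap_iff.2 inferInstance)
  let adj : G ⊣ ModuleCat.restrictScalars.{u} (algebraMap R S) :=
    ModuleCat.extendRestrictScalarsAdj _
  have : Limits.PreservesFiniteColimits G :=
    have := adj.leftAdjoint_preservesColimits
    inferInstance
  have := full_restrictScalars_ringOfFractions hZ
  have hker : G.kernel = torsionClass Z := by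
    ext M
    refine Iff.trans ?_ (subsingleton_tensor_iff hZ M)
    change Limits.IsZero (G.obj M) ↔ _
    rw [ModuleCat.isZero_iff_subsingleton]
    let e : (ModuleCat.restrictScalars (algebraMap R S)).obj (ModuleCat.of S S) ≃ₗ[R] S :=
      { AddEquiv.refl S with map_smul' := fun r s => (Algebra.smul_def (A := S) r s).symm }
    exact (TensorProduct.congr e (LinearEquiv.refl R M)).toEquiv.subsingleton_congr
  have hloc := Abelian.isLocalization_isoModSerre_kernel_of_leftAdjoint adj
  have hW : G.kernel.isoModSerre = (torsionClass Z).isoModSerre := isoModSerre_congr hker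
  rw [hW] at hloc
  exact ⟨S, inferInstance, ⟨Localization.uniq (torsionClass Z).isoModSerre.Q G
    (torsionClass Z).isoModSerre⟩⟩

end PerfectToModuleCategory

open ObjectProperty

/-- Additivity is forced by preservation of binary products. -/
theorem additive_functor_of_equivalence {R : Type u} [CommRing R]
    (Z : Set (PrimeSpectrum R)) {A : Type u} [Ring A] (e : QuotientCategory Z ≌ ModuleCat.{u} A) :
    e.functor.Additive := by
  have := SerreClassLocalization.hasFiniteProducts (torsionClass Z).isoModSerre.Q (torsionClass Z)
  exact Functor.additive_of_preserves_binary_products _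

/-! ### Localizations with values in `A`-Mod: generation and commutativity. -/

section ModuleCategoryToPerfect

variable {R : Type u} [CommRing R] (Z : Set (PrimeSpectrum R)) {A : Type u} [Ring A]
  (L : ModuleCat.{u} R ⥤ ModuleCat.{u} A)
  [hL : L.IsLocalization (torsionClass Z).isoModSerre]

include Z hL in
-- Multiplication by `r` is natural on `R`-Mod, and every morphism between objects `L X`, `L Y` is a
-- right fraction of such morphisms.
theorem map_smul_id_comp {X Y : ModuleCat.{u} R} (r : R) (s : L.obj X ⟶ L.obj Y) :
    L.map (r • 𝟙 X) ≫ s = s ≫ L.map (r • 𝟙 Y) := by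
  obtain ⟨φ, rfl⟩ := Localization.exists_rightFraction L (torsionClass Z).isoModSerre s
  have := Localization.inverts L (torsionClass Z).isoModSerre φ.s φ.hs
  rw [← cancel_epi (L.map φ.s), ← L.map_comp_assoc,
    MorphismProperty.RightFraction.map_s_comp_map_assoc, ← L.map_comp]
  have h : φ.s ≫ (r • 𝟙 X) = (r • 𝟙 _) ≫ φ.s := by simp
  rw [h, L.map_comp_assoc, MorphismProperty.RightFraction.map_s_comp_map, ← L.map_comp]
  congr 1
  simp

variable [L.Additive]

theorem map_elementHom_eq_zero_iff {X : ModuleCat.{u} R} (x : X) :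
    L.map (elementHom x) = 0 ↔ x ∈ torsionRadical Z X := by
  rw [SerreClassLocalization.map_eq_zero_iff L (torsionClass Z), torsionClass_image_iff]
  constructor
  · intro h
    simpa [elementHom] using h (1 : R)
  · intro h r
    exact Submodule.smul_mem _ r h

include Z hL in
-- So `L(R)` is a generator. Writing `h` as a left fraction with numerator `f`, the hypothesis says
-- that every `f x` is torsion; then the image of `f` is torsion and `L(f) = 0`.
theorem eq_zero_of_forall_map_elementHom_comp {X : ModuleCat.{u} R} {N : ModuleCat.{u} A}
    (h : L.obj X ⟶ N) (H : ∀ x : X, L.map (elementHom x) ≫ h = 0) : h = 0 := by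
  have := Localization.essSurj L (torsionClass Z).isoModSerre
  obtain ⟨φ, hφ⟩ := Localization.exists_leftFraction L (torsionClass Z).isoModSerre
    (h ≫ (L.objObjPreimageIso N).inv)
  have hφ' : h ≫ (L.objObjPreimageIso N).inv ≫ L.map φ.s = L.map φ.f := by
    rw [← Category.assoc, hφ, MorphismProperty.LeftFraction.map_comp_map_s]
  have := Localization.inverts L (torsionClass Z).isoModSerre φ.s φ.hs
  rw [← cancel_mono ((L.objObjPreimageIso N).inv ≫ L.map φ.s), Limits.zero_comp, hφ',
    SerreClassLocalization.map_eq_zero_iff L (torsionClass Z), torsionClass_image_iff]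
  intro x
  rw [← map_elementHom_eq_zero_iff Z L, ← elementHom_comp, L.map_comp, ← hφ', reassoc_of% (H x),
    Limits.zero_comp]

include Z hL in
-- After writing `s` as a right fraction and testing on elements of its source, numerator and
-- denominator become scalars of `R`, which commute with `t`.
theorem comp_comm (s t : L.obj (ModuleCat.of R R) ⟶ L.obj (ModuleCat.of R R)) :
    s ≫ t = t ≫ s := by
  obtain ⟨φ, hφ⟩ := Localization.exists_rightFraction L (torsionClass Z).isoModSerre s
  have := Localization.inverts L (torsionClass Z).isoModSerre φ.s φ.hs
  have hs : L.map φ.s ≫ s = L.map φ.f := by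
    rw [hφ, MorphismProperty.RightFraction.map_s_comp_map]
  rw [← sub_eq_zero, ← cancel_epi (L.map φ.s), Limits.comp_zero]
  refine eq_zero_of_forall_map_elementHom_comp Z L _ fun x => ?_
  rw [Preadditive.comp_sub, Preadditive.comp_sub, sub_eq_zero, reassoc_of% hs,
    ← L.map_comp_assoc, ← L.map_comp_assoc, elementHom_comp, elementHom_comp,
    elementHom_eq_smul, elementHom_eq_smul, map_smul_id_comp Z L, reassoc_of% map_smul_id_comp Z L,
    ← elementHom_eq_smul, ← elementHom_eq_smul, ← elementHom_comp, ← elementHom_comp, L.map_comp,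
    L.map_comp, Category.assoc, hs]

include Z hL in
-- Every map `L(R) → A` dies in `A / T`, where `T` is the trace ideal. As `A` is isomorphic to some
-- `L X` and `L(R)` detects zero maps, `A → A / T` vanishes.
theorem exists_trace_eq_one :
    ∃ (n : ℕ) (f : Fin n → Fiber L →ₗ[A] A) (b : Fin n → Fiber L), ∑ i, f i (b i) = 1 := by
  have := Localization.essSurj L (torsionClass Z).isoModSerre
  let T : Submodule A A := Submodule.span A {a | ∃ (f : Fiber L →ₗ[A] A) (b : Fiber L), a = f b}
  let α := L.objObjPreimageIso (ModuleCat.of A A)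
  let q : ModuleCat.of A A ⟶ ModuleCat.of A (A ⧸ T) := ModuleCat.ofHom T.mkQ
  have h : α.hom ≫ q = 0 := by
    refine eq_zero_of_forall_map_elementHom_comp Z L _ fun x => ?_
    refine ModuleCat.hom_ext (LinearMap.ext fun b => ?_)
    exact (Submodule.Quotient.mk_eq_zero T).2
      (Submodule.subset_span ⟨(L.map (elementHom x) ≫ α.hom).hom, b, rfl⟩)
  have hq : q = 0 := by rwa [← cancel_epi α.hom, Limits.comp_zero]
  have h1 : (1 : A) ∈ T := (Submodule.Quotient.mk_eq_zero T).1
    (LinearMap.congr_fun (congrArg ModuleCat.Hom.hom hq) (1 : A))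
  obtain ⟨n, a, g, hg⟩ := Submodule.mem_span_set'.1 h1
  choose f b hfb using fun i => (g i).2
  refine ⟨n, f, fun i => a i • b i, ?_⟩
  rw [← hg]
  exact Finset.sum_congr rfl fun i _ => by rw [map_smul, hfb]

/-! ### Identification of `R_Z` with the endomorphisms of `L(R)`. -/

instance isIso_map_subtype (i : GabrielIndex Z) : IsIso (L.map (ModuleCat.ofHom i.ideal.subtype)) :=
  Localization.inverts L _ _ (isoModSerre_subtype i.ideal_mem)

instance isIso_map_mkQ : IsIso (L.map (ModuleCat.ofHom (torsionIdeal Z).mkQ)) :=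
  Localization.inverts L _ _ isoModSerre_mkQ

/-- The endomorphism of `L(R)` induced by a homomorphism from an ideal in the Gabriel topology to
`R / Γ_Z(R)`. -/
def endOfFraction (i : GabrielIndex Z) : FractionHom Z i →ₗ[R] Module.End A (Fiber L) where
  toFun f := (inv (L.map (ModuleCat.ofHom i.ideal.subtype)) ≫ L.map (ModuleCat.ofHom f) ≫
    inv (L.map (ModuleCat.ofHom (torsionIdeal Z).mkQ))).hom
  map_add' f g := by
    rw [ModuleCat.ofHom_add, L.map_add, Preadditive.add_comp, Preadditive.comp_add,
      ModuleCat.hom_add]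
  map_smul' r f := by
    have h : ModuleCat.ofHom (r • f) = ModuleCat.ofHom f ≫ (r • 𝟙 _) := by ext; simp
    have h' := map_smul_id_comp Z L r (inv (L.map (ModuleCat.ofHom (torsionIdeal Z).mkQ)))
    rw [h, L.map_comp, Category.assoc, h', ← Category.assoc, ← Category.assoc, Category.assoc _ _
      (inv _)]
    rfl

theorem endOfFraction_eq_iff (i : GabrielIndex Z) (f : FractionHom Z i)
    (s : L.obj (ModuleCat.of R R) ⟶ L.obj (ModuleCat.of R R)) :
    endOfFraction Z L i f = s.hom ↔ L.map (ModuleCat.ofHom f) =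
      L.map (ModuleCat.ofHom i.ideal.subtype) ≫ s ≫
        L.map (ModuleCat.ofHom (torsionIdeal Z).mkQ) := by
  change (inv (L.map (ModuleCat.ofHom i.ideal.subtype)) ≫ L.map (ModuleCat.ofHom f) ≫
    inv (L.map (ModuleCat.ofHom (torsionIdeal Z).mkQ))).hom = s.hom ↔ _
  rw [← ModuleCat.hom_ext_iff, IsIso.inv_comp_eq, IsIso.comp_inv_eq, Category.assoc]

theorem endOfFraction_restrict (i j : GabrielIndex Z) (h : i ≤ j) (f : FractionHom Z i) :
    endOfFraction Z L j (FractionHom.restrict Z i j h f) = endOfFraction Z L i f := by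
  have h₁ := (endOfFraction_eq_iff Z L i f (ModuleCat.ofHom (endOfFraction Z L i f))).1 rfl
  refine (endOfFraction_eq_iff Z L j _ (ModuleCat.ofHom (endOfFraction Z L i f))).2 ?_
  let ι : ModuleCat.of R j.ideal ⟶ ModuleCat.of R i.ideal :=
    ModuleCat.ofHom (Submodule.inclusion (GabrielIndex.ideal_le h))
  have h₂ : ModuleCat.ofHom (FractionHom.restrict Z i j h f) = ι ≫ ModuleCat.ofHom f := rfl
  have h₃ : ModuleCat.ofHom j.ideal.subtype = ι ≫ ModuleCat.ofHom i.ideal.subtype := rfl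
  rw [h₂, h₃, L.map_comp, L.map_comp, h₁, Category.assoc]

/-- The map from the ring of fractions to the endomorphisms of `L(R)`. -/
def endOfRingOfFractions : RingOfFractions Z →ₗ[R] Module.End A (Fiber L) :=
  RingOfFractions.lift (endOfFraction Z L) (endOfFraction_restrict Z L)

/-- If `L(f) = 0`, the values of `f` are torsion in the torsion-free module `R / t(R)`. -/
theorem endOfRingOfFractions_injective : Function.Injective (endOfRingOfFractions Z L) := by
  refine (injective_iff_map_eq_zero _).2 fun z hz => ?_
  obtain ⟨i, f, rfl⟩ := RingOfFractions.exists_of z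
  rw [endOfRingOfFractions, RingOfFractions.lift_of] at hz
  have h := (endOfFraction_eq_iff Z L i f 0).1 hz
  rw [Limits.zero_comp, Limits.comp_zero,
    SerreClassLocalization.map_eq_zero_iff L (torsionClass Z), torsionClass_image_iff] at h
  have : f = 0 := LinearMap.ext fun x => mem_torsionRadical_quotient_torsionIdeal (h x)
  rw [this, map_zero]

theorem endOfRingOfFractions_surjective : Function.Surjective (endOfRingOfFractions Z L) := by
  intro e
  let s : L.obj (ModuleCat.of R R) ⟶ L.obj (ModuleCat.of R R) := ModuleCat.ofHom e
  obtain ⟨φ, hφ⟩ := Localization.exists_rightFraction L (torsionClass Z).isoModSerre s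
  have hs : L.map φ.s ≫ s = L.map φ.f := by
    rw [hφ, MorphismProperty.RightFraction.map_s_comp_map]
  -- The range of the denominator serves as the ideal of definition of the fraction.
  let i : GabrielIndex Z := OrderDual.toDual ⟨_, range_mem_gabrielTopology φ.hs⟩
  let w : φ.X' →ₗ[R] i.ideal := φ.s.hom.rangeRestrict
  have hw : Function.Surjective w := φ.s.hom.surjective_rangeRestrict
  -- The numerator sends the kernel of the denominator into `t(R)`, so modulo `t(R)` it descends to
  -- that ideal.
  have hker : LinearMap.ker w ≤ LinearMap.ker ((torsionIdeal Z).mkQ ∘ₗ φ.f.hom) := by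
    intro y hy
    have hy0 : φ.s.hom y = 0 := congrArg Subtype.val (LinearMap.mem_ker.1 hy)
    refine (Submodule.Quotient.mk_eq_zero _).2 ?_
    refine (map_elementHom_eq_zero_iff Z L (X := ModuleCat.of R R) _).1 ?_
    rw [← elementHom_comp, L.map_comp, ← hs, ← L.map_comp_assoc, elementHom_comp, hy0,
      (map_elementHom_eq_zero_iff Z L _).2 (zero_mem _), Limits.zero_comp]
  let g : FractionHom Z i := ((LinearMap.ker w).liftQ _ hker).comp
    (w.quotKerEquivOfSurjective hw).symm.toLinearMap
  have hg : g ∘ₗ w = (torsionIdeal Z).mkQ ∘ₗ φ.f.hom := by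
    refine LinearMap.ext fun y => ?_
    have : (w.quotKerEquivOfSurjective hw).symm (w y) = Submodule.Quotient.mk y := by
      rw [LinearEquiv.symm_apply_eq]; rfl
    change (LinearMap.ker w).liftQ _ hker ((w.quotKerEquivOfSurjective hw).symm (w y)) = _
    rw [this]
    rfl
  refine ⟨RingOfFractions.of Z i g, ?_⟩
  rw [endOfRingOfFractions, RingOfFractions.lift_of]
  refine (endOfFraction_eq_iff Z L i g s).2 ?_
  have : Epi (ModuleCat.ofHom w) := (ModuleCat.epi_iff_surjective _).2 hw
  have := SerreClassLocalization.preservesEpimorphisms L (torsionClass Z)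
  have h₁ : ModuleCat.ofHom w ≫ ModuleCat.ofHom g =
      φ.f ≫ ModuleCat.ofHom (torsionIdeal Z).mkQ := ModuleCat.hom_ext hg
  have h₂ : ModuleCat.ofHom w ≫ ModuleCat.ofHom i.ideal.subtype = φ.s := rfl
  rw [← cancel_epi (L.map (ModuleCat.ofHom w)), ← L.map_comp, h₁, ← L.map_comp_assoc, h₂,
    reassoc_of% hs, L.map_comp]

/-- The ring of fractions is isomorphic, as an `R`-module, to the endomorphism ring of `L(R)`. -/
def ringOfFractionsEquivEnd : RingOfFractions Z ≃ₗ[R] Module.End A (Fiber L) :=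
  LinearEquiv.ofBijective (endOfRingOfFractions Z L)
    ⟨endOfRingOfFractions_injective Z L, endOfRingOfFractions_surjective Z L⟩

include hL in
theorem isPerfect_of_isLocalization [IsNoetherianRing R] (hZ : StableUnderSpecialization Z) :
    IsPerfect Z := by
  have := SerreClassLocalization.preservesFiniteLimits L (torsionClass Z)
  have := SerreClassLocalization.preservesFiniteColimits L (torsionClass Z)
  have := flat_fiber L
  obtain ⟨n, f, b, hfb⟩ := exists_trace_eq_one Z L
  obtain ⟨m, g, c, hgc⟩ := exists_dualBasis_of_trace_eq_one (fun φ ψ =>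
    congrArg ModuleCat.Hom.hom (comp_comm Z L (ModuleCat.ofHom ψ) (ModuleCat.ofHom φ))) f b hfb
  -- An `R`-linear isomorphism suffices: flatness and `p R_Z = R_Z` depend only on the `R`-module
  -- structure.
  let e := ringOfFractionsEquivEnd Z L
  have := flat_end_of_dualBasis (R := R) hgc
  refine ⟨Module.Flat.of_linearEquiv e, Set.ext fun p => ?_⟩
  -- The chain is: `p ∈ Z` iff `R/p ∈ 𝒯_Z` iff `L(R/p) = 0` iff `p L(R) = L(R)` iff `p` times the
  -- endomorphism ring is everything.
  rw [← torsionClass_quotient_prime_iff hZ p,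
    ← SerreClassLocalization.isZero_obj_iff L (torsionClass Z), ← smul_top_fiber_eq_top_iff,
    ← smul_top_end_eq_top_iff hgc, Set.mem_ofPred_eq]
  change _ ↔ p.asIdeal.map (algebraMap R (RingOfFractions Z)) = ⊤
  rw [← Submodule.restrictScalars_eq_top_iff R (RingOfFractions Z) (RingOfFractions Z),
    ← Ideal.smul_top_eq_map,
    ← (Submodule.map_injective_of_injective e.injective).eq_iff, Submodule.map_smul'',
    Submodule.map_top, LinearEquiv.range]

end ModuleCategoryToPerfect

end SpecLocalization

end

theorem mainTheorem10 {R : Type u} [CommRing R] [IsNoetherianRing R]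
    (Z : Set (PrimeSpectrum R)) (hZ : StableUnderSpecialization Z) :
    SpecLocalization.IsModuleCategory.{u} (SpecLocalization.QuotientCategory Z) ↔
      SpecLocalization.IsPerfect Z := by
  constructor
  · rintro ⟨A, _, ⟨e⟩⟩
    have := SpecLocalization.additive_functor_of_equivalence Z e
    exact SpecLocalization.isPerfect_of_isLocalization Z
      ((SpecLocalization.torsionClass Z).isoModSerre.Q ⋙ e.functor) hZ
  · rintro ⟨_, h⟩
    exact SpecLocalization.isModuleCategory_of_flat h
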